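/- Let $n,m\ge 1$ be integers with $nm>1$. Consider $nm$ pairwise disjoint unit circles (trajectories) in the plane, indexed by pairs $(i,j)$ with $1\le i\le n$ (row) and $1\le j\le m$ (column), such that the centers of the circles of a row lie on a horizontal line and the centers of the circles of a column lie on a vertical line. Let $r$ be the communication range, and join two circles by an edge when their centers are at distance at most $2+r$; assume that this communication graph is the $n\times m$ grid, i.e. $(i,j)$ is adjacent exactly to those of $(i\pm1,j)$, $(i,j\pm1)$ that exist. For adjacent circles $C,C'$ the link position of $C$ with respect to $C'$ is the angle of the point of $C$ closest to $C'$. A schedule assigns to each circle $C$ a starting angle $f(C)$ and a direction $g(C)\in\{1,-1\}$; the position on $C$ at time $t\ge0$ is $f(C)+2\pi g(C)t$ modulo $2\pi$. Assume that the schedule is synchronized with neighbors in opposite directions: for adjacent $C,C'$ one has $g(C)=-g(C')$, and at each time $t\ge 0$ the position on $C$ is the link position of $C$ with respect to $C'$ if and only if the position on $C'$ is the link position of $C'$ with respect to $C$. Initially each circle carries one robot, which moves on it according to the schedule. Some robots may leave the system (fail), possibly at different times. When a remaining robot arrives at the link position of its circle $C$ with respect to a neighboring circle $C'$ and $C'$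 carries no remaining robot, it passes instantly to $C'$ and follows the schedule of $C'$; otherwise it stays on $C$. After the failures, a surviving robot starves if from then on, or from some later time on, every time it arrives at a link position with respect to a neighboring circle, that circle is empty. The system falls into starvation if, from some time on, all surviving robots starve (in particular if no robot survives). Then for every such system and schedule: 1. The isolation-resilience, i.e. the largest $k\le nm$ such that no failure of exactly $k$ robots (whichever they are and whenever they fail) makes the system fall into starvation, equals $nm-\min(n,m)-1$. 2. The starvation number, i.e. the maximum possible number of simultaneously starving robots after some (possibly no) robots have failed, equals $\min(n,m)$. 3. Two distinct starving robots are never, at any time from which both starve, in circles of the same row or in circles of the same column. -/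

import Mathlib

noncomputable section

open scoped Topology

namespace SyncRobots

/-- The geometric data of a system of robots: pairwise disjoint unit circles (the trajectories) in
the plane `ℂ`, indexed by `T`, and the communication range. There is one robot per trajectory, and
the robot that starts in the trajectory `u` is itself called `u`. -/
structure RobotSystem (T : Type*) where
  center : T → ℂ
  range : ℝ
  circles_disjoint : ∀ i j : T, i ≠ j →
    Disjoint (Metric.sphere (center i) 1) (Metric.sphere (center j) 1)

namespace RobotSystem

variable {T : Type*} (S : RobotSystem T)

/-- The communication graph: two distinct trajectories are adjacent iff the distance between their
centers is at most `2 + r`. -/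
def commGraph : SimpleGraph T where
  Adj i j := i ≠ j ∧ dist (S.center i) (S.center j) ≤ 2 + S.range
  symm := ⟨fun _ _ h => ⟨h.1.symm, by rw [dist_comm]; exact h.2⟩⟩
  loopless := ⟨fun _ h => h.1 rfl⟩

/-- The link position of the circle `i` with respect to the circle `j`: the angle of the point of
the circle `i` that is closest to the circle `j`, i.e. the direction from the center of `i` to the
center of `j`. -/
def linkPosition (i j : T) : Real.Angle :=
  ((S.center j - S.center i).arg : Real.Angle)

end RobotSystem

/-- A schedule: for each trajectory a starting position (an angle) and a direction of movement,
`1` for counterclockwise and `-1` for clockwise. -/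
structure Schedule (T : Type*) where
  start : T → Real.Angle
  dir : T → ℤˣ

/-- The scheduled position in the circle `i` at time `t` (one tour takes one unit of time). -/
def Schedule.pos {T : Type*} (F : Schedule T) (i : T) (t : ℝ) : Real.Angle :=
  F.start i + ((((F.dir i : ℤ) : ℝ) * (2 * Real.pi * t) : ℝ) : Real.Angle)

/-- The schedule synchronizes the system, with neighbors flying in opposite directions. -/
structure IsSCS {T : Type*} (S : RobotSystem T) (F : Schedule T) : Prop where
  synchronized : ∀ i j : T, S.commGraph.Adj i j → ∀ t : ℝ, 0 ≤ t →
    (F.pos i t = S.linkPosition i j ↔ F.pos j t = S.linkPosition j i)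
  opposite : ∀ i j : T, S.commGraph.Adj i j → F.dir i = - F.dir j

/-- A failure pattern: the finite set of robots that leave the system and the times at which they
leave (only the times of the members of `failed` matter). -/
structure FailurePattern (T : Type*) where
  failed : Finset T
  time : T → ℝ
  time_nonneg : ∀ u ∈ failed, 0 ≤ time u

/-- The robot `u` is still in the system at time `t`. -/
def FailurePattern.Alive {T : Type*} (P : FailurePattern T) (u : T) (t : ℝ) : Prop :=
  u ∈ P.failed → t < P.time u

section Motion

variable {T : Type*} (S : RobotSystem T) (F : Schedule T) (P : FailurePattern T)

/-- At time `t`, the circle `j` holds a robot that is still in the system. Here and below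
`loc u t` is the circle in which the robot `u` flies at time `t`; at an instant at which `u`
changes its circle, `loc u t` is the old one. -/
def Occupied (loc : T → ℝ → T) (j : T) (t : ℝ) : Prop :=
  ∃ v : T, P.Alive v t ∧ loc v t = j

/-- At time `t` the robot `u` arrives at the link position of its circle with respect to `j`. -/
def ArrivesAt (loc : T → ℝ → T) (u j : T) (t : ℝ) : Prop :=
  S.commGraph.Adj (loc u t) j ∧ F.pos (loc u t) t = S.linkPosition (loc u t) j

/-- `loc` is the motion of the robots under the failure pattern `P`. Each robot starts in its own
circle. A robot that arrives at a link position while the neighboring circle is empty passes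
instantly to that circle, and follows its schedule from then on; otherwise it stays in its circle.
(Should several link positions of one circle coincide, the robot passes to one of the corresponding
empty circles.) -/
structure IsMotion (loc : T → ℝ → T) : Prop where
  initial : ∀ u : T, loc u 0 = u
  left_cont : ∀ (u : T) (t : ℝ), 0 < t → P.Alive u t → ∀ᶠ s in 𝓝[<] t, loc u s = loc u t
  pass : ∀ (u : T) (t : ℝ), 0 ≤ t → P.Alive u t →
    (∃ j : T, ArrivesAt S F loc u j t ∧ ¬ Occupied P loc j t) →
    ∃ j : T, ArrivesAt S F loc u j t ∧ ¬ Occupied P loc j t ∧ ∀ᶠ s in 𝓝[>] t, loc u s = j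
  stay : ∀ (u : T) (t : ℝ), 0 ≤ t → P.Alive u t →
    (¬ ∃ j : T, ArrivesAt S F loc u j t ∧ ¬ Occupied P loc j t) →
    ∀ᶠ s in 𝓝[>] t, loc u s = loc u t

/-- From time `t₀` on, all failures having happened, the surviving robot `u` starves: every time it
arrives at a link position, the neighboring circle is empty. -/
def StarvesFrom (loc : T → ℝ → T) (t₀ : ℝ) (u : T) : Prop :=
  u ∉ P.failed ∧ 0 ≤ t₀ ∧ (∀ v ∈ P.failed, P.time v ≤ t₀) ∧
    ∀ t : ℝ, t₀ ≤ t → ∀ j : T, ArrivesAt S F loc u j t → ¬ Occupied P loc j t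

/-- From some time on, all failures having happened, all the surviving robots starve. (If no robot
survives, this holds.) -/
def FallsIntoStarvation (loc : T → ℝ → T) : Prop :=
  ∃ t₀ : ℝ, 0 ≤ t₀ ∧ (∀ v ∈ P.failed, P.time v ≤ t₀) ∧
    ∀ u : T, u ∉ P.failed → StarvesFrom S F P loc t₀ u

end Motion

/-- `R` is the isolation-resilience: the greatest number `k` of robots such that, whichever `k` of
the robots fail and whenever they fail, the system does not fall into starvation. -/
def IsIsolationResilience {T : Type*} [Fintype T] (S : RobotSystem T) (F : Schedule T) (R : ℕ) :
    Prop :=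
  IsGreatest {k : ℕ | k ≤ Fintype.card T ∧
    ∀ P : FailurePattern T, P.failed.card = k → ∀ loc : T → ℝ → T, IsMotion S F P loc →
      ¬ FallsIntoStarvation S F P loc} R

/-- `N` is the starvation number: the maximum possible number of robots that starve
simultaneously after some robots have left the system. -/
def IsStarvationNumber {T : Type*} (S : RobotSystem T) (F : Schedule T) (N : ℕ) : Prop :=
  IsGreatest {k : ℕ | ∃ (P : FailurePattern T) (loc : T → ℝ → T) (t₀ : ℝ),
    IsMotion S F P loc ∧ {u : T | StarvesFrom S F P loc t₀ u}.ncard = k} N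

/-- The trajectories are arranged in `n` rows and `m` columns (the trajectory `(i, j)` is in row `i`
and column `j`), the rows being horizontal and the columns vertical, and the communication graph is
the `n × m` grid: `(i, j)` is adjacent to `(i ± 1, j)` and `(i, j ± 1)` and to nothing else. -/
structure IsGrid {n m : ℕ} (S : RobotSystem (Fin n × Fin m)) : Prop where
  row : ∀ (i : Fin n) (j j' : Fin m), (S.center (i, j)).im = (S.center (i, j')).im
  column : ∀ (i i' : Fin n) (j : Fin m), (S.center (i, j)).re = (S.center (i', j)).re
  graph : S.commGraph = SimpleGraph.boxProd (SimpleGraph.pathGraph n) (SimpleGraph.pathGraph m)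

end SyncRobots

end

/-!
In a synchronized grid, neighbors fly in opposite directions and meet at their common link, so the
positions in neighboring circles are mirror images of each other (`cos_sin_pos`). Hence the position
in a single circle determines all others, and the links occur simultaneously, four times per tour:
alternately between columns paired off with neighboring columns and between rows paired off with
neighboring rows, the pairing changing from one occasion to the next. If all robots passed at all
links, the columns would be permuted by alternating odd-even transpositions of a path, and
independently the rows as well (`exists_isLinkClock`).

A robot that starves passes at every link, so from then on its column and its row follow these
transpositions. If two starving robots were in the same row, they would share a row forever, while
their columns are carried along by the odd-even transpositions. These take each column to the last
place, and on its way there it is exchanged with every column in front of it (`exists_pathStep_eq`).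
So the two robots would be in linked circles at some instant, and would not starve. Likewise for
columns (`StarvesFrom.row_ne_and_col_ne`). Therefore at most `min n m` robots starve at once.

Conversely, if the survivors of initial failures are in distinct rows and distinct columns, the
motion in which all of them pass at every link keeps them in distinct rows and columns, since links
permute rows and columns. As linked circles share a row or a column, no survivor ever finds another
one at a link, and all of them starve (`starvingMotion_isMotion`, `starvesFrom_starvingMotion`). Such
sets of survivors exist on the diagonal in all sizes up to `min n m`, whereas `min n m + 1`
survivors cannot all starve; this gives the starvation number and the isolation-resilience.
-/

open scoped Topology

namespace SyncRobots

/-! ### Odd-even transpositions of a path -/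

/-- The odd-even transposition of the path `0, …, n - 1` with phase `s`: the vertices of the same
parity as `s` are exchanged with their successors (the last vertex stays if it has none), and
hence those of the other parity with their predecessors (`0` stays, by truncated subtraction). -/
def pathStep (n : ℕ) (s : ℤ) (i : Fin n) : Fin n :=
  if Even (s + (i : ℤ)) then (if h : (i : ℕ) + 1 < n then ⟨i + 1, h⟩ else i)
  else ⟨i - 1, by omega⟩

lemma pathStep_val {n : ℕ} (s : ℤ) (i : Fin n) :
    (pathStep n s i : ℕ) =
      if (s + (i : ℤ)) % 2 = 0 then (if (i : ℕ) + 1 < n then (i : ℕ) + 1 else i)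
      else (i : ℕ) - 1 := by
  unfold pathStep
  simp only [Int.even_iff]
  split_ifs <;> rfl

lemma pathStep_involutive (n : ℕ) (s : ℤ) : Function.Involutive (pathStep n s) := by
  intro i
  apply Fin.ext
  have h1 := pathStep_val s i
  have h2 := pathStep_val s (pathStep n s i)
  have := i.isLt
  split_ifs at h1 h2 <;> omega

lemma pathStep_injective (n : ℕ) (s : ℤ) : Function.Injective (pathStep n s) :=
  (pathStep_involutive n s).injective

lemma pathStep_eq_iff {n : ℕ} (s : ℤ) {i j : Fin n} (hij : i ≠ j) :
    pathStep n s i = j ↔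
      ((i : ℕ) + 1 = j ∧ Even (s + (i : ℤ))) ∨ ((j : ℕ) + 1 = i ∧ ¬ Even (s + (i : ℤ))) := by
  have h1 := pathStep_val s i
  have hi := i.isLt
  have hj := j.isLt
  rw [Ne, Fin.ext_iff] at hij
  rw [Fin.ext_iff, Int.even_iff]
  split_ifs at h1 <;> omega

/-- Of two tokens carried along by alternating odd-even transpositions, the lower one has to pass
the other on its way to the top of the path. The quantity bounded by `N` is the number of steps
that the lower token `a` needs to get to the top; a descending token needs `n` steps more than its
height, as it has to get to the bottom first and waits there for one step. -/
lemma exists_pathStep_eq_of_lt {n : ℕ} (N : ℕ) : ∀ (s : ℤ) (a b : ℕ → Fin n),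
    (∀ h : ℕ, a (h + 1) = pathStep n (s + h) (a h)) →
    (∀ h : ℕ, b (h + 1) = pathStep n (s + h) (b h)) → a 0 < b 0 →
    (if Even (s + (a 0 : ℤ)) then n - 1 - (a 0 : ℕ) else n + (a 0 : ℕ)) ≤ N →
    ∃ h : ℕ, pathStep n (s + h) (a h) = b h := by
  induction N with
  | zero =>
    intro s a b _ _ hlt hN
    rw [Fin.lt_def] at hlt
    have := (b 0).isLt
    split_ifs at hN <;> omega
  | succ N ih =>
    intro s a b ha hb hlt hN
    by_cases h0 : pathStep n s (a 0) = b 0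
    · exact ⟨0, by simpa using h0⟩
    have ha1 : a 1 = pathStep n s (a 0) := by simpa using ha 0
    have hb1 : b 1 = pathStep n s (b 0) := by simpa using hb 0
    rw [Fin.ext_iff] at h0
    rw [Fin.lt_def] at hlt
    have hva := pathStep_val s (a 0)
    have hvb := pathStep_val s (b 0)
    have hltb := (b 0).isLt
    rw [← ha1] at hva h0
    rw [← hb1] at hvb
    simp only [Int.even_iff] at hN
    obtain ⟨h, hh⟩ := ih (s + 1) (fun h => a (h + 1)) (fun h => b (h + 1))
      (fun h => by rw [ha (h + 1)]; congr 1; push_cast; ring)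
      (fun h => by rw [hb (h + 1)]; congr 1; push_cast; ring)
      (by
        rw [Fin.lt_def]
        simp only [zero_add]
        split_ifs at hva hvb <;> omega)
      (by
        simp only [zero_add, Int.even_iff]
        split_ifs at hva hN ⊢ <;> omega)
    refine ⟨h + 1, ?_⟩
    rw [← hh]
    congr 1
    push_cast
    ring

lemma exists_pathStep_eq {n : ℕ} (s : ℤ) (a b : ℕ → Fin n)
    (ha : ∀ h : ℕ, a (h + 1) = pathStep n (s + h) (a h))
    (hb : ∀ h : ℕ, b (h + 1) = pathStep n (s + h) (b h)) (hne : a 0 ≠ b 0) :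
    ∃ h : ℕ, pathStep n (s + h) (a h) = b h := by
  rcases lt_or_gt_of_ne hne with hlt | hlt
  · exact exists_pathStep_eq_of_lt _ s a b ha hb hlt le_rfl
  · obtain ⟨h, hh⟩ := exists_pathStep_eq_of_lt _ s b a hb ha hlt le_rfl
    exact ⟨h, by rw [← hh, pathStep_involutive]⟩

/-! ### The links of the grid as a function of time -/

/-- The exchange of circles along the links of the grid at the `k`-th instant at which robots
arrive at link positions. At even `k` neighboring columns are exchanged in pairs, at odd `k`
neighboring rows; `p` and `q` are the phases of the columns and of the rows. -/
def gridStep {n m : ℕ} (p q k : ℤ) (x : Fin n × Fin m) : Fin n × Fin m :=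
  if Even k then (x.1, pathStep m (k / 2 + p) x.2) else (pathStep n (k / 2 + q) x.1, x.2)

/-- The circle that is linked at time `t` to the circle `x`, and `x` itself if there is none.
The clock `4 * t + c` shows integers at the instants of the links. -/
noncomputable def linkMap {n m : ℕ} (c : ℝ) (p q : ℤ) (t : ℝ) (x : Fin n × Fin m) : Fin n × Fin m :=
  if (⌊4 * t + c⌋ : ℝ) = 4 * t + c then gridStep p q ⌊4 * t + c⌋ x else x

section Links

variable {n m : ℕ} {c : ℝ} {p q : ℤ}

lemma gridStep_even (h : ℤ) (x : Fin n × Fin m) :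
    gridStep p q (2 * h) x = (x.1, pathStep m (h + p) x.2) := by
  simp [gridStep]

lemma gridStep_odd (h : ℤ) (x : Fin n × Fin m) :
    gridStep p q (2 * h + 1) x = (pathStep n (h + q) x.1, x.2) := by
  have : (2 * h + 1) / 2 = h := by omega
  simp [gridStep, this]

lemma gridStep_fst_inj {k : ℤ} {x y : Fin n × Fin m} :
    (gridStep p q k x).1 = (gridStep p q k y).1 ↔ x.1 = y.1 := by
  unfold gridStep
  split_ifs
  · rfl
  · exact (pathStep_injective _ _).eq_iff

lemma gridStep_snd_inj {k : ℤ} {x y : Fin n × Fin m} :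
    (gridStep p q k x).2 = (gridStep p q k y).2 ↔ x.2 = y.2 := by
  unfold gridStep
  split_ifs
  · exact (pathStep_injective _ _).eq_iff
  · rfl

lemma gridStep_same_line (k : ℤ) (x : Fin n × Fin m) :
    (gridStep p q k x).1 = x.1 ∨ (gridStep p q k x).2 = x.2 := by
  unfold gridStep
  split_ifs
  · exact Or.inl rfl
  · exact Or.inr rfl

lemma linkMap_of_eq {t : ℝ} {k : ℤ} (h : 4 * t + c = k) (x : Fin n × Fin m) :
    linkMap c p q t x = gridStep p q k x := by
  simp [linkMap, h]

lemma linkMap_of_ne {t : ℝ} (h : ∀ k : ℤ, 4 * t + c ≠ k) (x : Fin n × Fin m) :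
    linkMap c p q t x = x :=
  if_neg fun h' => h _ h'.symm

lemma linkMap_fst_inj {t : ℝ} {x y : Fin n × Fin m} :
    (linkMap c p q t x).1 = (linkMap c p q t y).1 ↔ x.1 = y.1 := by
  unfold linkMap
  split_ifs
  · exact gridStep_fst_inj
  · rfl

lemma linkMap_snd_inj {t : ℝ} {x y : Fin n × Fin m} :
    (linkMap c p q t x).2 = (linkMap c p q t y).2 ↔ x.2 = y.2 := by
  unfold linkMap
  split_ifs
  · exact gridStep_snd_inj
  · rfl

lemma linkMap_injective (t : ℝ) :
    Function.Injective (linkMap c p q t : Fin n × Fin m → Fin n × Fin m) := fun _ _ h =>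
  Prod.ext (linkMap_fst_inj.1 (congrArg Prod.fst h)) (linkMap_snd_inj.1 (congrArg Prod.snd h))

lemma linkMap_same_line (t : ℝ) (x : Fin n × Fin m) :
    (linkMap c p q t x).1 = x.1 ∨ (linkMap c p q t x).2 = x.2 := by
  unfold linkMap
  split_ifs
  · exact gridStep_same_line _ _
  · exact Or.inl rfl

end Links

/-- The clock `4 * t + c` and the phases `p`, `q` describe the links of the system: at time `t`
the scheduled position in `x` is the link position with respect to the neighbor `y` iff `linkMap`
sends `x` to `y`. -/
def IsLinkClock {n m : ℕ} (S : RobotSystem (Fin n × Fin m)) (F : Schedule (Fin n × Fin m))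
    (c : ℝ) (p q : ℤ) : Prop :=
  ∀ t : ℝ, 0 ≤ t → ∀ x y : Fin n × Fin m,
    (S.commGraph.Adj x y ∧ F.pos x t = S.linkPosition x y) ↔ (linkMap c p q t x = y ∧ y ≠ x)

/-! ### The motion between consecutive links -/

section Dynamics

variable {n m : ℕ} {S : RobotSystem (Fin n × Fin m)} {F : Schedule (Fin n × Fin m)}
  {P : FailurePattern (Fin n × Fin m)} {loc : Fin n × Fin m → ℝ → Fin n × Fin m}
  {c : ℝ} {p q : ℤ}

/-- Induction along the instants of the links, which are discrete: a property of times that holds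
at `0` and is inherited over intervals without links in their interior holds at all times. -/
lemma link_induction (c : ℝ) {Q : ℝ → Prop} (h0 : Q 0)
    (step : ∀ a b : ℝ, 0 ≤ a → a < b → (∀ t ∈ Set.Ioo a b, ∀ k : ℤ, 4 * t + c ≠ k) → Q a → Q b)
    {t : ℝ} (ht : 0 ≤ t) : Q t := by
  have key : ∀ (i : ℕ) (t : ℝ), 0 ≤ t → 4 * t + c ≤ ⌊c⌋ + i → Q t := by
    intro i
    induction i with
    | zero =>
      intro t ht hi
      have : t = 0 := by
        have := Int.floor_le c
        push_cast at hi
        linarith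
      rwa [this]
    | succ i ih =>
      intro t ht hi
      by_cases hle : 4 * t + c ≤ ⌊c⌋ + i
      · exact ih t ht hle
      rcases ht.eq_or_lt with rfl | htpos
      · exact h0
      push Not at hle
      push_cast at hi
      refine step (max 0 ((⌊c⌋ + i - c) / 4)) t (le_max_left _ _) (max_lt htpos (by linarith))
        ?_ ?_
      · rintro s ⟨hs1, hs2⟩ k hk
        have h1 := (le_max_right _ _).trans_lt hs1
        have h2 : ((⌊c⌋ + i : ℤ) : ℝ) < k := by push_cast; linarith
        have h3 : (k : ℝ) < ((⌊c⌋ + i + 1 : ℤ) : ℝ) := by push_cast; linarith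
        have h2' := Int.cast_lt.1 h2
        have h3' := Int.cast_lt.1 h3
        omega
      · rcases le_total ((⌊c⌋ + i - c) / 4) 0 with h | h
        · rwa [max_eq_left h]
        · rw [max_eq_right h]
          exact ih _ h (by linarith)
  obtain ⟨i, hi⟩ := exists_nat_ge (4 * t + c - ⌊c⌋)
  exact key i t ht (by linarith)

lemma FailurePattern.Alive.mono {T : Type*} {P : FailurePattern T} {u : T} {s t : ℝ}
    (h : P.Alive u t) (hst : s ≤ t) : P.Alive u s :=
  fun hu => hst.trans_lt (h hu)

lemma arrivesAt_iff (hC : IsLinkClock S F c p q) {t : ℝ} (ht : 0 ≤ t) {u j : Fin n × Fin m} :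
    ArrivesAt S F loc u j t ↔ linkMap c p q t (loc u t) = j ∧ j ≠ loc u t :=
  hC t ht _ _

open Classical in
/-- The circle of the robot `u` immediately after the time `t`. -/
noncomputable def nextLoc (P : FailurePattern (Fin n × Fin m))
    (loc : Fin n × Fin m → ℝ → Fin n × Fin m) (c : ℝ) (p q : ℤ) (u : Fin n × Fin m) (t : ℝ) :
    Fin n × Fin m :=
  if Occupied P loc (linkMap c p q t (loc u t)) t then loc u t else linkMap c p q t (loc u t)

lemma nextLoc_of_no_link {u : Fin n × Fin m} {t : ℝ} (h : ∀ k : ℤ, 4 * t + c ≠ k) :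
    nextLoc P loc c p q u t = loc u t := by
  unfold nextLoc
  rw [linkMap_of_ne h, ite_self]

lemma eventually_right_eq_nextLoc (hC : IsLinkClock S F c p q) (hM : IsMotion S F P loc)
    {u : Fin n × Fin m} {t : ℝ} (ht : 0 ≤ t) (hu : P.Alive u t) :
    ∀ᶠ s in 𝓝[>] t, loc u s = nextLoc P loc c p q u t := by
  by_cases h : ∃ j, ArrivesAt S F loc u j t ∧ ¬ Occupied P loc j t
  · obtain ⟨j, hj, hocc, hev⟩ := hM.pass u t ht hu h
    rw [arrivesAt_iff hC ht] at hj
    unfold nextLoc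
    rwa [hj.1, if_neg hocc]
  · have hev := hM.stay u t ht hu h
    unfold nextLoc
    split_ifs with hocc
    · exact hev
    · have hfix : linkMap c p q t (loc u t) = loc u t := by
        by_contra hne
        exact h ⟨_, (arrivesAt_iff hC ht).2 ⟨rfl, hne⟩, hocc⟩
      rwa [hfix]

lemma loc_eq_nextLoc (hC : IsLinkClock S F c p q) (hM : IsMotion S F P loc)
    {u : Fin n × Fin m} {a b : ℝ} (ha : 0 ≤ a) (hab : a < b)
    (hno : ∀ t ∈ Set.Ioo a b, ∀ k : ℤ, 4 * t + c ≠ k) (hu : P.Alive u b) :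
    loc u b = nextLoc P loc c p q u a := by
  let : TopologicalSpace (Fin n × Fin m) := ⊥
  have : DiscreteTopology (Fin n × Fin m) := ⟨rfl⟩
  -- In an interval without links a robot stays in its circle on both sides of each instant.
  have hcont : ContinuousOn (loc u) (Set.Ioo a b) := by
    intro t ht
    apply ContinuousAt.continuousWithinAt
    have htpos : 0 < t := ha.trans_lt ht.1
    have hut : P.Alive u t := hu.mono ht.2.le
    have hl := hM.left_cont u t htpos hut
    have hr := eventually_right_eq_nextLoc hC hM htpos.le hut
    rw [nextLoc_of_no_link (hno t ht)] at hr
    have : ∀ᶠ s in 𝓝 t, loc u s = loc u t := by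
      rw [← nhdsNE_sup_pure, ← nhdsLT_sup_nhdsGT]
      simp only [Filter.eventually_sup, Filter.eventually_pure, and_true]
      exact ⟨hl, hr⟩
    exact (Filter.EventuallyEq.tendsto this)
  obtain ⟨s, hs, hsI⟩ := ((eventually_right_eq_nextLoc hC hM ha (hu.mono hab.le)).and
    (Ioo_mem_nhdsGT hab)).exists
  obtain ⟨s', hs', hsI'⟩ := ((hM.left_cont u b (ha.trans_lt hab) hu).and
    (Ioo_mem_nhdsLT hab)).exists
  rw [← hs, ← hs', isPreconnected_Ioo.constant hcont hsI hsI']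

/-- At each time, every circle carries at most one robot of the system. -/
lemma eq_of_loc_eq (hC : IsLinkClock S F c p q) (hM : IsMotion S F P loc) {t : ℝ} (ht : 0 ≤ t) :
    ∀ u v : Fin n × Fin m, P.Alive u t → P.Alive v t → loc u t = loc v t → u = v := by
  refine link_induction c (Q := fun t => ∀ u v : Fin n × Fin m, P.Alive u t → P.Alive v t →
    loc u t = loc v t → u = v) ?_ ?_ ht
  · intro u v _ _ h
    rwa [hM.initial, hM.initial] at h
  · intro a b ha hab hno ih u v hu hv h
    rw [loc_eq_nextLoc hC hM ha hab hno hu, loc_eq_nextLoc hC hM ha hab hno hv] at h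
    have hua := hu.mono hab.le
    have hva := hv.mono hab.le
    apply ih u v hua hva
    unfold nextLoc at h
    split_ifs at h with h1 h2 h2
    · exact h
    · exact absurd ⟨u, hua, h⟩ h2
    · exact absurd ⟨v, hva, h.symm⟩ h1
    · exact linkMap_injective _ h

/-! ### Starving robots -/

lemma StarvesFrom.alive {t₀ : ℝ} {u : Fin n × Fin m} (h : StarvesFrom S F P loc t₀ u) (t : ℝ) :
    P.Alive u t :=
  fun hu => absurd hu h.1

lemma StarvesFrom.not_occupied (hC : IsLinkClock S F c p q) {t₀ t : ℝ} {u : Fin n × Fin m}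
    (h : StarvesFrom S F P loc t₀ u) (ht : t₀ ≤ t) (hne : linkMap c p q t (loc u t) ≠ loc u t) :
    ¬ Occupied P loc (linkMap c p q t (loc u t)) t :=
  h.2.2.2 t ht _ ((arrivesAt_iff hC (h.2.1.trans ht)).2 ⟨rfl, hne⟩)

lemma StarvesFrom.loc_eq_linkMap (hC : IsLinkClock S F c p q) (hM : IsMotion S F P loc)
    {t₀ a b : ℝ} {u : Fin n × Fin m} (h : StarvesFrom S F P loc t₀ u) (ha : t₀ ≤ a) (hab : a < b)
    (hno : ∀ t ∈ Set.Ioo a b, ∀ k : ℤ, 4 * t + c ≠ k) :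
    loc u b = linkMap c p q a (loc u a) := by
  rw [loc_eq_nextLoc hC hM (h.2.1.trans ha) hab hno (h.alive b)]
  unfold nextLoc
  split_ifs with hocc
  · by_contra hne
    exact h.not_occupied hC ha (Ne.symm hne) hocc
  · rfl

lemma StarvesFrom.loc_link_succ (hC : IsLinkClock S F c p q) (hM : IsMotion S F P loc)
    {t₀ : ℝ} {u : Fin n × Fin m} (h : StarvesFrom S F P loc t₀ u) {k : ℤ}
    (hk : t₀ ≤ (k - c) / 4) :
    loc u (((k + 1 : ℤ) - c) / 4) = gridStep p q k (loc u ((k - c) / 4)) := by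
  rw [h.loc_eq_linkMap hC hM hk (by push_cast; linarith), linkMap_of_eq (k := k) (by ring)]
  rintro t ⟨h1, h2⟩ l hl
  have h3 : (k : ℝ) < l := by linarith
  have h4 : (l : ℝ) < ((k + 1 : ℤ) : ℝ) := by linarith
  have h3' := Int.cast_lt.1 h3
  have h4' := Int.cast_lt.1 h4
  omega

/-- At the link with number `k`, a starving robot is not linked to the circle of another one. -/
lemma StarvesFrom.not_meet (hC : IsLinkClock S F c p q) (hM : IsMotion S F P loc)
    {t₀ : ℝ} {u v : Fin n × Fin m} (huv : u ≠ v) (hu : StarvesFrom S F P loc t₀ u)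
    (hv : StarvesFrom S F P loc t₀ v) {k : ℤ} (hk : t₀ ≤ (k - c) / 4) :
    gridStep p q k (loc u ((k - c) / 4)) ≠ loc v ((k - c) / 4) := by
  intro h
  have hlink := linkMap_of_eq (p := p) (q := q) (show 4 * ((k - c) / 4) + c = k by ring)
    (loc u ((k - c) / 4))
  refine hu.not_occupied hC hk ?_ ⟨v, hv.alive _, by rw [hlink, h]⟩
  rw [hlink, h]
  exact fun heq => huv (eq_of_loc_eq hC hM (hu.2.1.trans hk) u v (hu.alive _) (hv.alive _) heq.symm)

/-- Two starving robots are never in the same row or column: otherwise they would stay in a common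
row or column forever, and there meet at a link at some later time. -/
theorem StarvesFrom.row_ne_and_col_ne (hC : IsLinkClock S F c p q) (hM : IsMotion S F P loc)
    {t₀ : ℝ} {u v : Fin n × Fin m} (huv : u ≠ v) (hu : StarvesFrom S F P loc t₀ u)
    (hv : StarvesFrom S F P loc t₀ v) {t : ℝ} (ht : t₀ ≤ t) :
    (loc u t).1 ≠ (loc v t).1 ∧ (loc u t).2 ≠ (loc v t).2 := by
  set K : ℤ := ⌊4 * t + c⌋ + 1 with hK
  have htK : t < (K - c) / 4 := by
    have := Int.lt_floor_add_one (4 * t + c)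
    rw [hK]; push_cast; linarith
  have hnoK : ∀ s ∈ Set.Ioo t ((K - c) / 4), ∀ k : ℤ, 4 * s + c ≠ k := by
    rintro s ⟨h1, h2⟩ k hk
    have h3 : ⌊4 * t + c⌋ < k := Int.floor_lt.2 (by linarith)
    have h4 : (k : ℝ) < K := by linarith
    have h4' := Int.cast_lt.1 h4
    omega
  have hne : ∀ k : ℤ, K ≤ k → loc u ((k - c) / 4) ≠ loc v ((k - c) / 4) := fun k hk h =>
    huv (eq_of_loc_eq hC hM (by
      have : (K : ℝ) ≤ k := Int.cast_le.2 hk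
      linarith [hu.2.1]) u v (hu.alive _) (hv.alive _) h)
  have hle : ∀ k : ℤ, K ≤ k → t₀ ≤ (k - c) / 4 := fun k hk => by
    have : (K : ℝ) ≤ k := Int.cast_le.2 hk
    linarith
  -- Being in a common row, or in a common column, is preserved at all later links.
  have hrow : (loc u t).1 = (loc v t).1 → ∀ i : ℕ,
      (loc u (((K + i : ℤ) - c) / 4)).1 = (loc v (((K + i : ℤ) - c) / 4)).1 := by
    intro h i
    induction i with
    | zero =>
      rw [Nat.cast_zero, add_zero, hu.loc_eq_linkMap hC hM ht htK hnoK,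
        hv.loc_eq_linkMap hC hM ht htK hnoK]
      exact linkMap_fst_inj.2 h
    | succ i ih =>
      rw [Nat.cast_succ, ← add_assoc, hu.loc_link_succ hC hM (hle _ (by omega)),
        hv.loc_link_succ hC hM (hle _ (by omega))]
      exact gridStep_fst_inj.2 ih
  have hcol : (loc u t).2 = (loc v t).2 → ∀ i : ℕ,
      (loc u (((K + i : ℤ) - c) / 4)).2 = (loc v (((K + i : ℤ) - c) / 4)).2 := by
    intro h i
    induction i with
    | zero =>
      rw [Nat.cast_zero, add_zero, hu.loc_eq_linkMap hC hM ht htK hnoK,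
        hv.loc_eq_linkMap hC hM ht htK hnoK]
      exact linkMap_snd_inj.2 h
    | succ i ih =>
      rw [Nat.cast_succ, ← add_assoc, hu.loc_link_succ hC hM (hle _ (by omega)),
        hv.loc_link_succ hC hM (hle _ (by omega))]
      exact gridStep_snd_inj.2 ih
  constructor
  · intro h
    -- In the common row, the columns change at the links with even numbers.
    set H : ℤ := (K + 1) / 2 with hH
    have hKH : ∀ i : ℕ, K ≤ 2 * (H + i) := fun i => by omega
    have hsucc : ∀ w, StarvesFrom S F P loc t₀ w → ∀ i : ℕ,
        (loc w (((2 * (H + (i + 1 : ℕ)) : ℤ) - c) / 4)).2 =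
          pathStep m (H + p + i) (loc w (((2 * (H + i) : ℤ) - c) / 4)).2 := by
      intro w hw i
      rw [show (2 * (H + (i + 1 : ℕ)) : ℤ) = 2 * (H + i) + 1 + 1 by push_cast; ring,
        hw.loc_link_succ hC hM (hle _ (by have := hKH i; omega)), gridStep_odd,
        hw.loc_link_succ hC hM (hle _ (hKH i)), gridStep_even, add_right_comm H p]
    have hrow' : ∀ i : ℕ, (loc u (((2 * (H + i) : ℤ) - c) / 4)).1 =
        (loc v (((2 * (H + i) : ℤ) - c) / 4)).1 := fun i => by
      have := hrow h (2 * (H + i) - K).toNat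
      rwa [Int.toNat_of_nonneg (by have := hKH i; omega), add_sub_cancel] at this
    obtain ⟨i, hi⟩ := exists_pathStep_eq (H + p)
      (fun i : ℕ => (loc u (((2 * (H + i) : ℤ) - c) / 4)).2)
      (fun i : ℕ => (loc v (((2 * (H + i) : ℤ) - c) / 4)).2) (hsucc u hu) (hsucc v hv)
      (fun h0 => hne _ (hKH 0) (Prod.ext (hrow' 0) h0))
    refine hu.not_meet hC hM huv hv (hle _ (hKH i)) ?_
    rw [gridStep_even]
    refine Prod.ext (hrow' i) ?_
    rw [← hi, add_right_comm H p]
  · intro h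
    -- In the common column, the rows change at the links with odd numbers.
    set H : ℤ := K / 2 with hH
    have hKH : ∀ i : ℕ, K ≤ 2 * (H + i) + 1 := fun i => by omega
    have hsucc : ∀ w, StarvesFrom S F P loc t₀ w → ∀ i : ℕ,
        (loc w (((2 * (H + (i + 1 : ℕ)) + 1 : ℤ) - c) / 4)).1 =
          pathStep n (H + q + i) (loc w (((2 * (H + i) + 1 : ℤ) - c) / 4)).1 := by
      intro w hw i
      rw [show (2 * (H + (i + 1 : ℕ)) + 1 : ℤ) = 2 * (H + i) + 1 + 1 + 1 by push_cast; ring,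
        hw.loc_link_succ hC hM (hle _ (by have := hKH i; omega)),
        show (2 * (H + i) + 1 + 1 : ℤ) = 2 * (H + i + 1) by ring, gridStep_even,
        show (2 * (H + i + 1) : ℤ) = 2 * (H + i) + 1 + 1 by ring,
        hw.loc_link_succ hC hM (hle _ (hKH i)), gridStep_odd, add_right_comm H q]
    have hcol' : ∀ i : ℕ, (loc u (((2 * (H + i) + 1 : ℤ) - c) / 4)).2 =
        (loc v (((2 * (H + i) + 1 : ℤ) - c) / 4)).2 := fun i => by
      have := hcol h (2 * (H + i) + 1 - K).toNat
      rwa [Int.toNat_of_nonneg (by have := hKH i; omega), add_sub_cancel] at this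
    obtain ⟨i, hi⟩ := exists_pathStep_eq (H + q)
      (fun i : ℕ => (loc u (((2 * (H + i) + 1 : ℤ) - c) / 4)).1)
      (fun i : ℕ => (loc v (((2 * (H + i) + 1 : ℤ) - c) / 4)).1) (hsucc u hu) (hsucc v hv)
      (fun h0 => hne _ (hKH 0) (Prod.ext h0 (hcol' 0)))
    refine hu.not_meet hC hM huv hv (hle _ (hKH i)) ?_
    rw [gridStep_odd]
    refine Prod.ext ?_ (hcol' i)
    rw [← hi, add_right_comm H q]

/-- No more than `min n m` robots starve simultaneously, as they are in distinct rows and in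
distinct columns. -/
lemma ncard_starving_le (hC : IsLinkClock S F c p q) (hM : IsMotion S F P loc) (t₀ : ℝ) :
    {u | StarvesFrom S F P loc t₀ u}.ncard ≤ min n m := by
  refine le_min ?_ ?_
  · refine (Set.ncard_le_ncard_of_injOn (fun u => (loc u t₀).1) (fun _ _ => Set.mem_univ _)
      (fun u hu v hv h => ?_) Set.finite_univ).trans_eq (by simp [Set.ncard_univ])
    by_contra hne
    exact (StarvesFrom.row_ne_and_col_ne hC hM hne hu hv le_rfl).1 h
  · refine (Set.ncard_le_ncard_of_injOn (fun u => (loc u t₀).2) (fun _ _ => Set.mem_univ _)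
      (fun u hu v hv h => ?_) Set.finite_univ).trans_eq (by simp [Set.ncard_univ])
    by_contra hne
    exact (StarvesFrom.row_ne_and_col_ne hC hM hne hu hv le_rfl).2 h

end Dynamics

/-! ### Synchronized schedules on the grid -/

section Geometry

variable {T : Type*} {S : RobotSystem T} {F : Schedule T}

lemma RobotSystem.center_injective (S : RobotSystem T) : Function.Injective S.center := by
  intro i j h
  by_contra hne
  have hd := S.circles_disjoint i j hne
  rw [h, disjoint_self] at hd
  exact (NormedSpace.sphere_nonempty (x := S.center j) (r := 1)).2 zero_le_one |>.ne_empty hd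

lemma cos_linkPosition {i j : T} (hij : i ≠ j) : (S.linkPosition i j).cos =
    ((S.center j).re - (S.center i).re) / ‖S.center j - S.center i‖ := by
  rw [RobotSystem.linkPosition, Real.Angle.cos_coe,
    Complex.cos_arg (sub_ne_zero.2 (S.center_injective.ne hij.symm)), Complex.sub_re]

lemma sin_linkPosition (i j : T) : (S.linkPosition i j).sin =
    ((S.center j).im - (S.center i).im) / ‖S.center j - S.center i‖ := by
  rw [RobotSystem.linkPosition, Real.Angle.sin_coe, Complex.sin_arg, Complex.sub_im]

lemma angle_eq_iff_cos_sin {θ ψ : Real.Angle} : θ = ψ ↔ θ.cos = ψ.cos ∧ θ.sin = ψ.sin := by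
  refine ⟨fun h => by simp [h], fun h => ?_⟩
  induction θ using Real.Angle.induction_on
  induction ψ using Real.Angle.induction_on
  exact Real.Angle.cos_sin_inj h.1 h.2

lemma div_abs_eq_neg_one_zpow {r : ℝ} {e : ℤ} (h : 0 < (-1 : ℝ) ^ e * r) :
    r / |r| = (-1) ^ e := by
  rcases Int.even_or_odd e with he | he
  · rw [he.neg_one_zpow] at h ⊢
    rw [one_mul] at h
    rw [abs_of_pos h, div_self h.ne']
  · rw [he.neg_one_zpow] at h ⊢
    have h' : r < 0 := by linarith
    rw [abs_of_neg h', div_neg, div_self h'.ne]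

lemma linkPosition_horizontal {i j : T} {e : ℤ} (him : (S.center i).im = (S.center j).im)
    (h : 0 < (-1 : ℝ) ^ e * ((S.center j).re - (S.center i).re)) :
    (S.linkPosition i j).cos = (-1) ^ e ∧ (S.linkPosition i j).sin = 0 := by
  have hij : i ≠ j := by
    rintro rfl
    simp at h
  have hnorm : ‖S.center j - S.center i‖ = |(S.center j).re - (S.center i).re| := by
    rw [← Complex.sub_re, Complex.abs_re_eq_norm.2 (by rw [Complex.sub_im, him, sub_self])]
  rw [cos_linkPosition hij, sin_linkPosition, him, sub_self, zero_div, hnorm,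
    div_abs_eq_neg_one_zpow h]
  exact ⟨rfl, rfl⟩

lemma linkPosition_vertical {i j : T} {e : ℤ} (hre : (S.center i).re = (S.center j).re)
    (h : 0 < (-1 : ℝ) ^ e * ((S.center j).im - (S.center i).im)) :
    (S.linkPosition i j).cos = 0 ∧ (S.linkPosition i j).sin = (-1) ^ e := by
  have hij : i ≠ j := by
    rintro rfl
    simp at h
  have hnorm : ‖S.center j - S.center i‖ = |(S.center j).im - (S.center i).im| := by
    rw [← Complex.sub_im, Complex.abs_im_eq_norm.2 (by rw [Complex.sub_re, hre, sub_self])]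
  rw [cos_linkPosition hij, sin_linkPosition, hre, sub_self, zero_div, hnorm,
    div_abs_eq_neg_one_zpow h]
  exact ⟨rfl, rfl⟩

lemma Schedule.exists_pos_eq (F : Schedule T) (i : T) (θ : Real.Angle) :
    ∃ t : ℝ, 0 ≤ t ∧ F.pos i t = θ := by
  unfold Schedule.pos
  induction θ using Real.Angle.induction_on with | _ b =>
  induction F.start i using Real.Angle.induction_on with | _ a =>
  set d : ℤ := (F.dir i : ℤ) with hd
  have hdd : (d : ℝ) * d = 1 := by
    rw [hd]; exact_mod_cast Int.units_coe_mul_self (F.dir i)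
  obtain ⟨N, hN⟩ := exists_nat_ge (-((d : ℝ) * (b - a) / (2 * Real.pi)))
  refine ⟨(d : ℝ) * (b - a) / (2 * Real.pi) + N, by linarith, ?_⟩
  rw [← Real.Angle.coe_add, Real.Angle.angle_eq_iff_two_pi_dvd_sub]
  refine ⟨d * N, ?_⟩
  have hpi := Real.pi_ne_zero
  push_cast
  field_simp
  linear_combination (b - a) * hdd

/-- As neighbors fly in opposite directions, the sum of their positions is constant; by
synchronization it is the sum of their link positions. -/
lemma pos_add_pos (hF : IsSCS S F) {i j : T} (h : S.commGraph.Adj i j) (t : ℝ) :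
    F.pos i t + F.pos j t = S.linkPosition i j + S.linkPosition j i := by
  have hsum : ∀ s : ℝ, F.pos i s + F.pos j s = F.start i + F.start j := by
    intro s
    unfold Schedule.pos
    rw [hF.opposite i j h, Units.val_neg, Int.cast_neg, neg_mul, Real.Angle.coe_neg]
    abel
  obtain ⟨s, hs, hi⟩ := F.exists_pos_eq i (S.linkPosition i j)
  rw [hsum, ← hsum s, hi, (hF.synchronized i j h s hs).1 hi]

lemma pos_horizontal_neighbor (hF : IsSCS S F) {i j : T} (h : S.commGraph.Adj i j)
    (him : (S.center i).im = (S.center j).im) (t : ℝ) :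
    (F.pos j t).cos = -(F.pos i t).cos ∧ (F.pos j t).sin = (F.pos i t).sin := by
  have hne := h.1
  have hre : (S.center j).re - (S.center i).re ≠ 0 := fun h0 =>
    hne (S.center_injective (Complex.ext (by linarith) him))
  obtain ⟨e, he⟩ : ∃ e : ℤ, 0 < (-1 : ℝ) ^ e * ((S.center j).re - (S.center i).re) := by
    rcases hre.lt_or_gt with h0 | h0
    · exact ⟨1, by simpa using h0⟩
    · exact ⟨0, by simpa using h0⟩
  have h1 := linkPosition_horizontal him he
  have h2 := linkPosition_horizontal (e := e + 1) him.symm (by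
    rw [zpow_add_one₀ (by norm_num)]; linarith)
  have hs := eq_sub_of_add_eq' (pos_add_pos hF h t)
  have hee : ((-1 : ℝ) ^ e) * (-1) ^ e = 1 := by
    rw [← mul_zpow]; norm_num
  rw [zpow_add_one₀ (by norm_num)] at h2
  rw [hs, sub_eq_add_neg]
  simp only [Real.Angle.cos_add, Real.Angle.sin_add, Real.Angle.cos_neg, Real.Angle.sin_neg, h1,
    h2]
  constructor
  · linear_combination -(F.pos i t).cos * hee
  · linear_combination (F.pos i t).sin * hee

lemma pos_vertical_neighbor (hF : IsSCS S F) {i j : T} (h : S.commGraph.Adj i j)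
    (hre : (S.center i).re = (S.center j).re) (t : ℝ) :
    (F.pos j t).cos = (F.pos i t).cos ∧ (F.pos j t).sin = -(F.pos i t).sin := by
  have hne := h.1
  have him : (S.center j).im - (S.center i).im ≠ 0 := fun h0 =>
    hne (S.center_injective (Complex.ext hre (by linarith)))
  obtain ⟨e, he⟩ : ∃ e : ℤ, 0 < (-1 : ℝ) ^ e * ((S.center j).im - (S.center i).im) := by
    rcases him.lt_or_gt with h0 | h0
    · exact ⟨1, by simpa using h0⟩
    · exact ⟨0, by simpa using h0⟩
  have h1 := linkPosition_vertical hre he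
  have h2 := linkPosition_vertical (e := e + 1) hre.symm (by
    rw [zpow_add_one₀ (by norm_num)]; linarith)
  have hs := eq_sub_of_add_eq' (pos_add_pos hF h t)
  have hee : ((-1 : ℝ) ^ e) * (-1) ^ e = 1 := by
    rw [← mul_zpow]; norm_num
  rw [zpow_add_one₀ (by norm_num)] at h2
  rw [hs, sub_eq_add_neg]
  simp only [Real.Angle.cos_add, Real.Angle.sin_add, Real.Angle.cos_neg, Real.Angle.sin_neg, h1,
    h2]
  constructor
  · linear_combination (F.pos i t).cos * hee
  · linear_combination -(F.pos i t).sin * hee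

/-- Points of the line whose proximity graph is a path are in monotone order. -/
lemma exists_monotone_of_proximity_path {n : ℕ} (x : Fin n → ℝ) (hx : Function.Injective x) (R : ℝ)
    (h : ∀ i j : Fin n, i ≠ j → (|x i - x j| ≤ R ↔ (i : ℕ) + 1 = j ∨ (j : ℕ) + 1 = i)) :
    ∃ p : ℤ, ∀ i j : Fin n, (i : ℕ) + 1 = j → 0 < (-1 : ℝ) ^ p * (x j - x i) := by
  rcases Nat.lt_or_ge n 2 with hn | hn
  · exact ⟨0, fun i j hij => by omega⟩
  have h01 : x ⟨1, hn⟩ - x ⟨0, by omega⟩ ≠ 0 :=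
    sub_ne_zero.2 (hx.ne (by simp))
  obtain ⟨p, hp⟩ : ∃ p : ℤ, 0 < (-1 : ℝ) ^ p * (x ⟨1, hn⟩ - x ⟨0, by omega⟩) := by
    rcases h01.lt_or_gt with h0 | h0
    · exact ⟨1, by simpa using h0⟩
    · exact ⟨0, by simpa using h0⟩
  have key : ∀ (i : ℕ) (hi : i + 1 < n),
      0 < (-1 : ℝ) ^ p * (x ⟨i + 1, hi⟩ - x ⟨i, by omega⟩) := by
    intro i
    induction i with
    | zero => exact fun _ => hp
    | succ i ih =>
      intro hi
      have ha := ih (by omega)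
      have habs : ∀ r : ℝ, |(-1 : ℝ) ^ p * r| = |r| := fun r => by
        rw [abs_mul, abs_zpow, abs_neg, abs_one, one_zpow, one_mul]
      by_contra hb
      push Not at hb
      have h1 := (h ⟨i + 1, by omega⟩ ⟨i, by omega⟩ (by simp)).2 (by simp)
      have h2 := (h ⟨i + 1 + 1, hi⟩ ⟨i + 1, by omega⟩ (by simp)).2 (by simp)
      -- If the second step went back, the ends of the two steps would be close to each other.
      have h3 : |x ⟨i + 1 + 1, hi⟩ - x ⟨i, by omega⟩| ≤ R := by
        rw [← habs, abs_le] at h1 h2 ⊢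
        constructor <;> linarith
      rw [h _ _ (by simp [Fin.ext_iff]; omega)] at h3
      simp only at h3
      omega
  refine ⟨p, fun i j hij => ?_⟩
  have := key i (hij ▸ j.isLt)
  rwa [show (⟨(i : ℕ) + 1, hij ▸ j.isLt⟩ : Fin n) = j from Fin.ext hij] at this

end Geometry

section GridGeometry

variable {n m : ℕ} {S : RobotSystem (Fin n × Fin m)} {F : Schedule (Fin n × Fin m)}

lemma IsGrid.adj_iff (hS : IsGrid S) {x y : Fin n × Fin m} : S.commGraph.Adj x y ↔
    (((x.1 : ℕ) + 1 = y.1 ∨ (y.1 : ℕ) + 1 = x.1) ∧ x.2 = y.2) ∨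
    (((x.2 : ℕ) + 1 = y.2 ∨ (y.2 : ℕ) + 1 = x.2) ∧ x.1 = y.1) := by
  rw [hS.graph, SimpleGraph.boxProd_adj, SimpleGraph.pathGraph_adj, SimpleGraph.pathGraph_adj]

lemma RobotSystem.dist_le_iff (S : RobotSystem (Fin n × Fin m)) {x y : Fin n × Fin m} (hxy : x ≠ y) :
    dist (S.center x) (S.center y) ≤ 2 + S.range ↔ S.commGraph.Adj x y :=
  ⟨fun h => ⟨hxy, h⟩, fun h => h.2⟩

lemma IsGrid.exists_column_order (hS : IsGrid S) (i₀ : Fin n) :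
    ∃ p : ℤ, ∀ (i : Fin n) (j j' : Fin m), (j : ℕ) + 1 = j' →
      0 < (-1 : ℝ) ^ p * ((S.center (i, j')).re - (S.center (i, j)).re) := by
  obtain ⟨p, hp⟩ := exists_monotone_of_proximity_path (fun j => (S.center (i₀, j)).re)
    (fun j j' h => (Prod.ext_iff.1 (S.center_injective
      (Complex.ext h (hS.row i₀ j j')))).2) (2 + S.range) (fun j j' hne => by
      have hne' : ((i₀, j) : Fin n × Fin m) ≠ (i₀, j') := fun h => hne (Prod.ext_iff.1 h).2
      have := S.dist_le_iff hne'
      rw [dist_eq_norm, ← Complex.abs_re_eq_norm.2 (by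
        rw [Complex.sub_im, hS.row i₀ j j', sub_self]), Complex.sub_re, hS.adj_iff] at this
      rw [this]
      simp [hne])
  exact ⟨p, fun i j j' h => by
    rw [hS.column i i₀ j, hS.column i i₀ j']
    exact hp j j' h⟩

lemma IsGrid.exists_row_order (hS : IsGrid S) (j₀ : Fin m) :
    ∃ q : ℤ, ∀ (i i' : Fin n) (j : Fin m), (i : ℕ) + 1 = i' →
      0 < (-1 : ℝ) ^ q * ((S.center (i', j)).im - (S.center (i, j)).im) := by
  obtain ⟨q, hq⟩ := exists_monotone_of_proximity_path (fun i => (S.center (i, j₀)).im)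
    (fun i i' h => (Prod.ext_iff.1 (S.center_injective
      (Complex.ext (hS.column i i' j₀) h))).1) (2 + S.range) (fun i i' hne => by
      have hne' : ((i, j₀) : Fin n × Fin m) ≠ (i', j₀) := fun h => hne (Prod.ext_iff.1 h).1
      have := S.dist_le_iff hne'
      rw [dist_eq_norm, ← Complex.abs_im_eq_norm.2 (by
        rw [Complex.sub_re, hS.column i i' j₀, sub_self]), Complex.sub_im, hS.adj_iff] at this
      rw [this]
      simp [hne])
  exact ⟨q, fun i i' j h => by
    rw [hS.row i j j₀, hS.row i' j j₀]
    exact hq i i' h⟩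

/-- The positions in the circles are mirror images of each other: each step to a neighboring column
is a reflection in the vertical axis, and each step to a neighboring row is a reflection in the
horizontal one. -/
lemma cos_sin_pos (hS : IsGrid S) (hF : IsSCS S F) (hn : 0 < n) (hm : 0 < m)
    (x : Fin n × Fin m) (t : ℝ) :
    (F.pos x t).cos = (-1) ^ (x.2 : ℤ) * (F.pos (⟨0, hn⟩, ⟨0, hm⟩) t).cos ∧
    (F.pos x t).sin = (-1) ^ (x.1 : ℤ) * (F.pos (⟨0, hn⟩, ⟨0, hm⟩) t).sin := by
  have hfirst : ∀ (j : ℕ) (hj : j < m),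
      (F.pos (⟨0, hn⟩, ⟨j, hj⟩) t).cos =
        (-1) ^ (j : ℤ) * (F.pos (⟨0, hn⟩, ⟨0, hm⟩) t).cos ∧
      (F.pos (⟨0, hn⟩, ⟨j, hj⟩) t).sin = (F.pos (⟨0, hn⟩, ⟨0, hm⟩) t).sin := by
    intro j
    induction j with
    | zero => simp
    | succ j ih =>
      intro hj
      have h := pos_horizontal_neighbor hF (i := (⟨0, hn⟩, ⟨j, by omega⟩))
        (j := (⟨0, hn⟩, ⟨j + 1, hj⟩)) (hS.adj_iff.2 (by simp)) (hS.row _ _ _) t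
      have ih' := ih (by omega)
      rw [h.1, h.2, ih'.1, ih'.2, Nat.cast_succ, zpow_add_one₀ (by norm_num)]
      exact ⟨by ring, rfl⟩
  have hall : ∀ (i : ℕ) (hi : i < n),
      (F.pos (⟨i, hi⟩, x.2) t).cos = (F.pos (⟨0, hn⟩, x.2) t).cos ∧
      (F.pos (⟨i, hi⟩, x.2) t).sin = (-1) ^ (i : ℤ) * (F.pos (⟨0, hn⟩, x.2) t).sin := by
    intro i
    induction i with
    | zero => simp
    | succ i ih =>
      intro hi
      have h := pos_vertical_neighbor hF (i := (⟨i, by omega⟩, x.2))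
        (j := (⟨i + 1, hi⟩, x.2)) (hS.adj_iff.2 (by simp)) (hS.column _ _ _) t
      have ih' := ih (by omega)
      rw [h.1, h.2, ih'.1, ih'.2, Nat.cast_succ, zpow_add_one₀ (by norm_num)]
      exact ⟨rfl, by ring⟩
  have h1 := hall x.1 x.1.isLt
  have h2 := hfirst x.2 x.2.isLt
  exact ⟨h1.1.trans h2.1, h1.2.trans (congrArg _ h2.2)⟩

lemma neg_one_zpow_eq_iff {a b : ℤ} : (-1 : ℝ) ^ a = (-1) ^ b ↔ Even (a + b) := by
  rw [Int.even_add]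
  rcases Int.even_or_odd a with ha | ha <;> rcases Int.even_or_odd b with hb | hb <;>
    simp only [ha.neg_one_zpow, hb.neg_one_zpow] <;>
    simp only [← Int.not_odd_iff_even, ha, hb] <;> norm_num

lemma cos_eq_and_sin_eq_zero_iff {X : ℝ} {e : ℤ} :
    (Real.cos (Real.pi / 2 * X) = (-1) ^ e ∧ Real.sin (Real.pi / 2 * X) = 0) ↔
      ∃ h : ℤ, X = 2 * h ∧ Even (h + e) := by
  have key : ∀ h : ℤ, Real.cos (Real.pi / 2 * (2 * h)) = (-1) ^ h := fun h => by
    rw [← Real.cos_int_mul_pi]; congr 1; ring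
  constructor
  · rintro ⟨hc, hs⟩
    obtain ⟨h, hh⟩ := Real.sin_eq_zero_iff.1 hs
    have hX : X = 2 * h := by
      have := Real.pi_ne_zero
      field_simp at hh
      linarith
    rw [hX, key, neg_one_zpow_eq_iff] at hc
    exact ⟨h, hX, hc⟩
  · rintro ⟨h, rfl, he⟩
    refine ⟨by rw [key, neg_one_zpow_eq_iff]; exact he, Real.sin_eq_zero_iff.2 ⟨h, by ring⟩⟩

lemma cos_eq_zero_and_sin_eq_iff {X : ℝ} {e : ℤ} :
    (Real.cos (Real.pi / 2 * X) = 0 ∧ Real.sin (Real.pi / 2 * X) = (-1) ^ e) ↔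
      ∃ h : ℤ, X = 2 * h + 1 ∧ Even (h + e) := by
  have hcos : Real.cos (Real.pi / 2 * X) = -Real.sin (Real.pi / 2 * (X - 1)) := by
    rw [show Real.pi / 2 * X = Real.pi / 2 * (X - 1) + Real.pi / 2 by ring,
      Real.cos_add_pi_div_two]
  have hsin : Real.sin (Real.pi / 2 * X) = Real.cos (Real.pi / 2 * (X - 1)) := by
    rw [show Real.pi / 2 * X = Real.pi / 2 * (X - 1) + Real.pi / 2 by ring,
      Real.sin_add_pi_div_two]
  rw [hcos, hsin, neg_eq_zero, and_comm, cos_eq_and_sin_eq_zero_iff]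
  simp only [sub_eq_iff_eq_add]

lemma linkMap_eq_iff {c : ℝ} {p q : ℤ} {t : ℝ} {x y : Fin n × Fin m} (hxy : x ≠ y) :
    linkMap c p q t x = y ↔
      (∃ h : ℤ, 4 * t + c = 2 * h ∧ x.1 = y.1 ∧ pathStep m (h + p) x.2 = y.2) ∨
      (∃ h : ℤ, 4 * t + c = 2 * h + 1 ∧ pathStep n (h + q) x.1 = y.1 ∧ x.2 = y.2) := by
  constructor
  · intro hl
    by_cases hk : ∃ k : ℤ, 4 * t + c = k
    · obtain ⟨k, hk⟩ := hk
      rw [linkMap_of_eq hk] at hl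
      rcases Int.even_or_odd' k with ⟨h, rfl | rfl⟩
      · rw [gridStep_even] at hl
        subst hl
        exact Or.inl ⟨h, by rw [hk]; push_cast; ring, rfl, rfl⟩
      · rw [gridStep_odd] at hl
        subst hl
        exact Or.inr ⟨h, by rw [hk]; push_cast; ring, rfl, rfl⟩
    · push Not at hk
      exact absurd (linkMap_of_ne hk x ▸ hl) hxy
  · rintro (⟨h, hh, h1, h2⟩ | ⟨h, hh, h1, h2⟩)
    · rw [linkMap_of_eq (k := 2 * h) (by rw [hh]; push_cast; ring), gridStep_even]
      exact Prod.ext h1 h2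
    · rw [linkMap_of_eq (k := 2 * h + 1) (by rw [hh]; push_cast; ring), gridStep_odd]
      exact Prod.ext h1 h2

/-- The links of a synchronized grid are the odd-even transpositions of its columns and of its
rows, in alternation: by reflection, the position in the circle `(0, 0)` determines the others, and
the link positions are met when that position is a multiple of `π / 2`. -/
theorem exists_isLinkClock (hS : IsGrid S) (hF : IsSCS S F) (hn : 0 < n) (hm : 0 < m) :
    ∃ (c : ℝ) (p q : ℤ), IsLinkClock S F c p q := by
  obtain ⟨p, hp⟩ := hS.exists_column_order ⟨0, hn⟩
  obtain ⟨q, hq⟩ := hS.exists_row_order ⟨0, hm⟩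
  obtain ⟨a, ha⟩ : ∃ a : ℝ, (a : Real.Angle) = F.start (⟨0, hn⟩, ⟨0, hm⟩) := by
    induction F.start (⟨0, hn⟩, ⟨0, hm⟩) using Real.Angle.induction_on with | _ a =>
    exact ⟨a, rfl⟩
  obtain ⟨δ, hδ⟩ : ∃ δ : ℤ, (((F.dir (⟨0, hn⟩, ⟨0, hm⟩) : ℤ)) : ℝ) = (-1) ^ δ := by
    rcases Int.units_eq_one_or (F.dir (⟨0, hn⟩, ⟨0, hm⟩)) with h | h
    · exact ⟨0, by simp [h]⟩
    · exact ⟨1, by simp [h]⟩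
  have hδδ : ((-1 : ℝ) ^ δ) * (-1) ^ δ = 1 := by
    rw [← mul_zpow]; norm_num
  refine ⟨(-1) ^ δ * (2 * a / Real.pi), p, q + δ, fun t _ x y => ?_⟩
  set c : ℝ := (-1) ^ δ * (2 * a / Real.pi) with hc
  have hpos : F.pos (⟨0, hn⟩, ⟨0, hm⟩) t =
      (((-1) ^ δ * (Real.pi / 2 * (4 * t + c)) : ℝ) : Real.Angle) := by
    unfold Schedule.pos
    rw [← ha, hδ, ← Real.Angle.coe_add]
    congr 1
    have := Real.pi_ne_zero
    rw [hc]
    field_simp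
    linear_combination -2 * a * hδδ
  have hcos : (F.pos x t).cos = (-1) ^ (x.2 : ℤ) * Real.cos (Real.pi / 2 * (4 * t + c)) := by
    rw [(cos_sin_pos hS hF hn hm x t).1, hpos, Real.Angle.cos_coe]
    rcases Int.even_or_odd δ with h | h <;> simp [h.neg_one_zpow]
  have hsin : (F.pos x t).sin =
      (-1) ^ (x.1 + δ : ℤ) * Real.sin (Real.pi / 2 * (4 * t + c)) := by
    rw [(cos_sin_pos hS hF hn hm x t).2, hpos, Real.Angle.sin_coe, zpow_add₀ (by norm_num)]
    rcases Int.even_or_odd δ with h | h <;> simp [h.neg_one_zpow]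
  have hcancel : ∀ (e f : ℤ) (r : ℝ), (-1 : ℝ) ^ e * r = (-1) ^ f ↔ r = (-1) ^ (e + f) := by
    intro e f r
    have hee : ((-1 : ℝ) ^ e) * (-1) ^ e = 1 := by
      rw [← mul_zpow]; norm_num
    rw [zpow_add₀ (by norm_num)]
    exact ⟨fun h => by rw [← h, ← mul_assoc, hee, one_mul],
      fun h => by rw [h, ← mul_assoc, hee, one_mul]⟩
  have hzero : ∀ (e : ℤ) (r : ℝ), (-1 : ℝ) ^ e * r = 0 ↔ r = 0 := fun e r => by
    simp [zpow_ne_zero]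
  -- The condition on the position, for horizontal and for vertical neighbors.
  have hhor : ∀ e : ℤ, x.1 = y.1 →
      0 < (-1 : ℝ) ^ e * ((S.center y).re - (S.center x).re) →
      (F.pos x t = S.linkPosition x y ↔
        ∃ h : ℤ, 4 * t + c = 2 * h ∧ Even (h + (x.2 + e))) := by
    intro e h1 he
    have him : (S.center x).im = (S.center y).im := by
      have := hS.row x.1 x.2 y.2
      rwa [show (x.1, y.2) = y from Prod.ext h1 rfl] at this
    have hl := linkPosition_horizontal him he
    rw [angle_eq_iff_cos_sin, hl.1, hl.2, hcos, hsin, hcancel, hzero, cos_eq_and_sin_eq_zero_iff]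
  have hver : ∀ e : ℤ, x.2 = y.2 →
      0 < (-1 : ℝ) ^ e * ((S.center y).im - (S.center x).im) →
      (F.pos x t = S.linkPosition x y ↔
        ∃ h : ℤ, 4 * t + c = 2 * h + 1 ∧ Even (h + (x.1 + δ + e))) := by
    intro e h1 he
    have hre : (S.center x).re = (S.center y).re := by
      have := hS.column x.1 y.1 x.2
      rwa [show (y.1, x.2) = y from Prod.ext rfl h1] at this
    have hl := linkPosition_vertical hre he
    rw [angle_eq_iff_cos_sin, hl.1, hl.2, hcos, hsin, hcancel, hzero, cos_eq_zero_and_sin_eq_iff]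
  have hflip : ∀ (e : ℤ) (r s : ℝ), 0 < (-1 : ℝ) ^ e * (r - s) →
      0 < (-1 : ℝ) ^ (e + 1) * (s - r) := fun e r s h => by
    rw [zpow_add_one₀ (by norm_num)]; linarith
  obtain ⟨x1, x2⟩ := x
  obtain ⟨y1, y2⟩ := y
  dsimp only at hhor hver
  constructor
  · rintro ⟨hadj, hp'⟩
    refine ⟨?_, hadj.1.symm⟩
    rw [linkMap_eq_iff hadj.1]
    rcases hS.adj_iff.1 hadj with ⟨h | h, h'⟩ | ⟨h | h, h'⟩ <;> dsimp only at h h' <;> subst h'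
    · obtain ⟨k, hk, hev⟩ := (hver q rfl (hq _ _ _ h)).1 hp'
      refine Or.inr ⟨k, hk, (pathStep_eq_iff _ (by rintro rfl; simp at h)).2 (Or.inl ⟨h, ?_⟩), rfl⟩
      convert hev using 1; ring
    · obtain ⟨k, hk, hev⟩ := (hver (q + 1) rfl (hflip _ _ _ (hq _ _ _ h))).1 hp'
      refine Or.inr ⟨k, hk, (pathStep_eq_iff _ (by rintro rfl; simp at h)).2 (Or.inr ⟨h, ?_⟩), rfl⟩
      rw [Int.even_iff] at hev ⊢
      dsimp only
      omega
    · obtain ⟨k, hk, hev⟩ := (hhor p rfl (hp _ _ _ h)).1 hp'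
      refine Or.inl ⟨k, hk, rfl, (pathStep_eq_iff _ (by rintro rfl; simp at h)).2 (Or.inl ⟨h, ?_⟩)⟩
      convert hev using 1; ring
    · obtain ⟨k, hk, hev⟩ := (hhor (p + 1) rfl (hflip _ _ _ (hp _ _ _ h))).1 hp'
      refine Or.inl ⟨k, hk, rfl, (pathStep_eq_iff _ (by rintro rfl; simp at h)).2 (Or.inr ⟨h, ?_⟩)⟩
      rw [Int.even_iff] at hev ⊢
      dsimp only
      omega
  · rintro ⟨hl, hne⟩
    rw [linkMap_eq_iff hne.symm] at hl
    rcases hl with ⟨k, hk, h', h⟩ | ⟨k, hk, h, h'⟩ <;> dsimp only at h h' <;> subst h'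
    · rw [pathStep_eq_iff _ (by rintro rfl; exact hne rfl)] at h
      rcases h with ⟨h, hev⟩ | ⟨h, hev⟩
      · refine ⟨hS.adj_iff.2 (Or.inr ⟨Or.inl h, rfl⟩), (hhor p rfl (hp _ _ _ h)).2 ⟨k, hk, ?_⟩⟩
        convert hev using 1; ring
      · refine ⟨hS.adj_iff.2 (Or.inr ⟨Or.inr h, rfl⟩),
          (hhor (p + 1) rfl (hflip _ _ _ (hp _ _ _ h))).2 ⟨k, hk, ?_⟩⟩
        rw [Int.even_iff] at hev ⊢
        omega
    · rw [pathStep_eq_iff _ (by rintro rfl; exact hne rfl)] at h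
      rcases h with ⟨h, hev⟩ | ⟨h, hev⟩
      · refine ⟨hS.adj_iff.2 (Or.inl ⟨Or.inl h, rfl⟩), (hver q rfl (hq _ _ _ h)).2 ⟨k, hk, ?_⟩⟩
        convert hev using 1; ring
      · refine ⟨hS.adj_iff.2 (Or.inl ⟨Or.inr h, rfl⟩),
          (hver (q + 1) rfl (hflip _ _ _ (hq _ _ _ h))).2 ⟨k, hk, ?_⟩⟩
        rw [Int.even_iff] at hev ⊢
        omega

end GridGeometry

/-! ### Survivors in distinct rows and columns -/

section Diagonal

variable {n m : ℕ} {S : RobotSystem (Fin n × Fin m)} {F : Schedule (Fin n × Fin m)}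
  {c : ℝ} {p q : ℤ}

/-- The circle to which the first `i` links from number `k` on carry the circle `x`. -/
def gridWalk (p q k : ℤ) : ℕ → Fin n × Fin m → Fin n × Fin m
  | 0, x => x
  | i + 1, x => gridStep p q (k + i) (gridWalk p q k i x)

lemma gridWalk_fst_inj {k : ℤ} (i : ℕ) {x y : Fin n × Fin m} :
    (gridWalk p q k i x).1 = (gridWalk p q k i y).1 ↔ x.1 = y.1 := by
  induction i with
  | zero => rfl
  | succ i ih => exact gridStep_fst_inj.trans ih

lemma gridWalk_snd_inj {k : ℤ} (i : ℕ) {x y : Fin n × Fin m} :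
    (gridWalk p q k i x).2 = (gridWalk p q k i y).2 ↔ x.2 = y.2 := by
  induction i with
  | zero => rfl
  | succ i ih => exact gridStep_snd_inj.trans ih

/-- The motion of robots that pass to the linked circle at each link. The links before the time `t`
are those with a number `k` such that `c ≤ k < 4 * t + c`. -/
noncomputable def starvingMotion (c : ℝ) (p q : ℤ) (u : Fin n × Fin m) (t : ℝ) : Fin n × Fin m :=
  gridWalk p q ⌈c⌉ (⌈4 * t + c⌉ - ⌈c⌉).toNat u

lemma starvingMotion_congr {u : Fin n × Fin m} {s t : ℝ} (h : ⌈4 * s + c⌉ = ⌈4 * t + c⌉) :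
    starvingMotion c p q u s = starvingMotion c p q u t := by
  unfold starvingMotion
  rw [h]

lemma starvingMotion_eventually_left (u : Fin n × Fin m) (t : ℝ) :
    ∀ᶠ s in 𝓝[<] t, starvingMotion c p q u s = starvingMotion c p q u t := by
  have h : (⌈4 * t + c⌉ - 1 - c) / 4 < t := by
    linarith [Int.ceil_lt_add_one (4 * t + c)]
  filter_upwards [Ioo_mem_nhdsLT h] with s hs
  apply starvingMotion_congr
  rw [Int.ceil_eq_iff]
  have := Int.le_ceil (4 * t + c)
  exact ⟨by linarith [hs.1], by linarith [hs.2]⟩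

lemma starvingMotion_eventually_right (u : Fin n × Fin m) {t : ℝ} (ht : 0 ≤ t) :
    ∀ᶠ s in 𝓝[>] t, starvingMotion c p q u s =
      linkMap c p q t (starvingMotion c p q u t) := by
  have h : t < (⌊4 * t + c⌋ + 1 - c) / 4 := by
    linarith [Int.lt_floor_add_one (4 * t + c)]
  filter_upwards [Ioo_mem_nhdsGT h] with s hs
  have hfl := Int.floor_le (4 * t + c)
  have hs' : ⌈4 * s + c⌉ = ⌊4 * t + c⌋ + 1 := by
    rw [Int.ceil_eq_iff]
    push_cast
    exact ⟨by linarith [hs.1], by linarith [hs.2]⟩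
  by_cases hk : ∃ k : ℤ, 4 * t + c = k
  · obtain ⟨k, hk⟩ := hk
    have hck : ⌈c⌉ ≤ k := Int.ceil_le.2 (by linarith)
    rw [linkMap_of_eq hk]
    unfold starvingMotion
    rw [hs', hk, Int.floor_intCast, Int.ceil_intCast,
      show (k + 1 - ⌈c⌉).toNat = (k - ⌈c⌉).toNat + 1 by omega, gridWalk,
      Int.toNat_of_nonneg (by omega), add_sub_cancel]
  · push Not at hk
    rw [linkMap_of_ne hk]
    apply starvingMotion_congr
    rw [hs', eq_comm, Int.ceil_eq_iff]
    push_cast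
    have := hk ⌊4 * t + c⌋
    exact ⟨by simpa using lt_of_le_of_ne hfl this.symm, (Int.lt_floor_add_one _).le⟩

lemma starvingMotion_zero (u : Fin n × Fin m) : starvingMotion c p q u 0 = u := by
  simp [starvingMotion, gridWalk]

/-- The failure pattern in which all robots outside `D` leave at time `0`. -/
def failOutside (D : Finset (Fin n × Fin m)) : FailurePattern (Fin n × Fin m) where
  failed := Dᶜ
  time _ := 0
  time_nonneg _ _ := le_rfl

lemma failOutside_alive_iff {D : Finset (Fin n × Fin m)} {u : Fin n × Fin m} {t : ℝ}
    (ht : 0 ≤ t) : (failOutside D).Alive u t ↔ u ∈ D := by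
  simp [FailurePattern.Alive, failOutside, ht.not_gt]

/-- Robots that start in distinct rows and distinct columns and always pass never meet, because all
links permute the rows and the columns, and linked circles share a row or a column. -/
lemma starvingMotion_not_occupied {D : Finset (Fin n × Fin m)}
    (hD1 : Set.InjOn Prod.fst (D : Set (Fin n × Fin m)))
    (hD2 : Set.InjOn Prod.snd (D : Set (Fin n × Fin m))) {u : Fin n × Fin m} (hu : u ∈ D)
    {t : ℝ} (ht : 0 ≤ t)
    (hne : linkMap c p q t (starvingMotion c p q u t) ≠ starvingMotion c p q u t) :
    ¬ Occupied (failOutside D) (starvingMotion c p q)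
      (linkMap c p q t (starvingMotion c p q u t)) t := by
  rintro ⟨v, hv, hloc⟩
  rw [failOutside_alive_iff ht] at hv
  have huv : v = u := by
    rcases linkMap_same_line (c := c) (p := p) (q := q) t (starvingMotion c p q u t) with h | h
    · rw [← hloc] at h
      exact hD1 hv hu ((gridWalk_fst_inj _).1 h)
    · rw [← hloc] at h
      exact hD2 hv hu ((gridWalk_snd_inj _).1 h)
  exact hne (huv ▸ hloc.symm)

lemma starvingMotion_isMotion (hC : IsLinkClock S F c p q) {D : Finset (Fin n × Fin m)}
    (hD1 : Set.InjOn Prod.fst (D : Set (Fin n × Fin m)))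
    (hD2 : Set.InjOn Prod.snd (D : Set (Fin n × Fin m))) :
    IsMotion S F (failOutside D) (starvingMotion c p q) where
  initial := starvingMotion_zero
  left_cont u t _ _ := starvingMotion_eventually_left u t
  pass u t ht _ := by
    rintro ⟨j, hj, hocc⟩
    refine ⟨j, hj, hocc, ?_⟩
    rw [← ((arrivesAt_iff hC ht).1 hj).1]
    exact starvingMotion_eventually_right u ht
  stay u t ht hu h := by
    rw [failOutside_alive_iff ht] at hu
    have hfix : linkMap c p q t (starvingMotion c p q u t) = starvingMotion c p q u t := by
      by_contra hne
      exact h ⟨_, (arrivesAt_iff hC ht).2 ⟨rfl, hne⟩,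
        starvingMotion_not_occupied hD1 hD2 hu ht hne⟩
    have := starvingMotion_eventually_right (c := c) (p := p) (q := q) u ht
    rwa [hfix] at this

lemma starvesFrom_starvingMotion (hC : IsLinkClock S F c p q) {D : Finset (Fin n × Fin m)}
    (hD1 : Set.InjOn Prod.fst (D : Set (Fin n × Fin m)))
    (hD2 : Set.InjOn Prod.snd (D : Set (Fin n × Fin m))) {u : Fin n × Fin m} :
    StarvesFrom S F (failOutside D) (starvingMotion c p q) 0 u ↔ u ∈ D := by
  constructor
  · intro h
    simpa [failOutside] using h.1
  · intro hu
    refine ⟨by simpa [failOutside] using hu, le_rfl, fun v _ => le_rfl, fun t ht j hj => ?_⟩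
    obtain ⟨rfl, hne⟩ := (arrivesAt_iff hC ht).1 hj
    exact starvingMotion_not_occupied hD1 hD2 hu ht hne

/-- There are `k ≤ min n m` circles in distinct rows and distinct columns, on the diagonal. -/
lemma exists_diagonal {k : ℕ} (hk : k ≤ min n m) : ∃ D : Finset (Fin n × Fin m),
    D.card = k ∧ Set.InjOn Prod.fst (D : Set (Fin n × Fin m)) ∧
      Set.InjOn Prod.snd (D : Set (Fin n × Fin m)) := by
  have hn : k ≤ n := hk.trans (min_le_left _ _)
  have hm : k ≤ m := hk.trans (min_le_right _ _)
  refine ⟨Finset.univ.image fun i : Fin k => (Fin.castLE hn i, Fin.castLE hm i), ?_, ?_, ?_⟩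
  · rw [Finset.card_image_of_injective _ fun i j h =>
      Fin.castLE_injective hn (Prod.ext_iff.1 h).1, Finset.card_univ, Fintype.card_fin]
  · rintro x hx y hy h
    simp only [Finset.coe_image, Set.mem_image] at hx hy
    obtain ⟨i, -, rfl⟩ := hx
    obtain ⟨j, -, rfl⟩ := hy
    rw [Fin.castLE_injective hn h]
  · rintro x hx y hy h
    simp only [Finset.coe_image, Set.mem_image] at hx hy
    obtain ⟨i, -, rfl⟩ := hx
    obtain ⟨j, -, rfl⟩ := hy
    rw [Fin.castLE_injective hm h]

lemma min_lt_mul (h : 1 < n * m) : min n m < n * m := by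
  have hn : n ≠ 0 := by rintro rfl; simp at h
  have hm : m ≠ 0 := by rintro rfl; simp at h
  rcases Nat.lt_or_ge 1 m with h1 | h1
  · exact (min_le_left n m).trans_lt (lt_mul_of_one_lt_right (Nat.pos_of_ne_zero hn) h1)
  · have : m = 1 := by omega
    subst this
    exact (min_le_right n 1).trans_lt h

/-- Of `min n m + 1` survivors not all can starve, whereas any smaller number of survivors on the
diagonal starve if the other robots leave at time `0`. -/
theorem isIsolationResilience_of_isLinkClock (hC : IsLinkClock S F c p q) (hnm : 1 < n * m) :
    IsIsolationResilience S F (n * m - min n m - 1) := by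
  have hlt := min_lt_mul hnm
  have hcard : Fintype.card (Fin n × Fin m) = n * m := by simp
  constructor
  · refine ⟨by omega, fun P hP loc hM => ?_⟩
    rintro ⟨t₀, -, -, hst⟩
    have hle := ncard_starving_le hC hM t₀
    have hsub : ((P.failedᶜ : Finset _) : Set (Fin n × Fin m)) ⊆
        {u | StarvesFrom S F P loc t₀ u} := fun u hu => hst u (by simpa using hu)
    have h1 := Set.ncard_le_ncard hsub
    rw [Set.ncard_coe_finset, Finset.card_compl, hP, hcard] at h1
    omega
  · rintro k ⟨hk, hall⟩
    by_contra hgt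
    obtain ⟨D, hD, hD1, hD2⟩ := exists_diagonal (n := n) (m := m) (k := n * m - k) (by omega)
    refine hall (failOutside D) ?_ _ (starvingMotion_isMotion hC hD1 hD2)
      ⟨0, le_rfl, fun _ _ => le_rfl, fun u hu => ?_⟩
    · change (Dᶜ).card = k
      rw [Finset.card_compl, hD, hcard]
      omega
    · exact (starvesFrom_starvingMotion hC hD1 hD2).2 (by simpa [failOutside] using hu)

theorem isStarvationNumber_of_isLinkClock (hC : IsLinkClock S F c p q) :
    IsStarvationNumber S F (min n m) := by
  constructor
  · obtain ⟨D, hD, hD1, hD2⟩ := exists_diagonal (n := n) (m := m) le_rfl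
    refine ⟨failOutside D, starvingMotion c p q, 0, starvingMotion_isMotion hC hD1 hD2, ?_⟩
    simp only [starvesFrom_starvingMotion hC hD1 hD2]
    exact (Set.ncard_coe_finset D).trans hD
  · rintro k ⟨P, loc, t₀, hM, rfl⟩
    exact ncard_starving_le hC hM t₀

end Diagonal

end SyncRobots

theorem mainTheorem1 (n m : ℕ) (hnm : 1 < n * m)
    (S : SyncRobots.RobotSystem (Fin n × Fin m)) (hS : SyncRobots.IsGrid S)
    (F : SyncRobots.Schedule (Fin n × Fin m)) (hF : SyncRobots.IsSCS S F) :
    SyncRobots.IsIsolationResilience S F (n * m - min n m - 1) ∧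
    SyncRobots.IsStarvationNumber S F (min n m) ∧
    (∀ (P : SyncRobots.FailurePattern (Fin n × Fin m)) (loc : Fin n × Fin m → ℝ → Fin n × Fin m),
      SyncRobots.IsMotion S F P loc → ∀ (t₀ : ℝ) (u v : Fin n × Fin m), u ≠ v →
        SyncRobots.StarvesFrom S F P loc t₀ u → SyncRobots.StarvesFrom S F P loc t₀ v →
        ∀ t : ℝ, t₀ ≤ t → (loc u t).1 ≠ (loc v t).1 ∧ (loc u t).2 ≠ (loc v t).2) := by
  have hn : 0 < n := Nat.pos_of_ne_zero (by rintro rfl; simp at hnm)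
  have hm : 0 < m := Nat.pos_of_ne_zero (by rintro rfl; simp at hnm)
  obtain ⟨c, p, q, hC⟩ := SyncRobots.exists_isLinkClock hS hF hn hm
  exact ⟨SyncRobots.isIsolationResilience_of_isLinkClock hC hnm,
    SyncRobots.isStarvationNumber_of_isLinkClock hC,
    fun P loc hM t₀ u v huv hu hv t ht => hu.row_ne_and_col_ne hC hM huv hv ht⟩
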